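/- Let $B_6 = O(6,\mathbb{Z})$ be the hyperoctahedral group of all orthogonal integral $6\times 6$ matrices, and let $B_6^+ = \{A \in B_6 : \det A = 1\}$. Let $\hat{\mathcal{I}} \le B_6$ be the subgroup generated by $$ \begin{pmatrix}0&0&0&0&0&1\\0&0&0&0&1&0\\0&0&-1&0&0&0\\0&0&0&-1&0&0\\0&1&0&0&0&0\\1&0&0&0&0&0\end{pmatrix},\qquad \begin{pmatrix}0&0&0&0&0&1\\0&0&0&1&0&0\\0&-1&0&0&0&0\\0&0&-1&0&0&0\\1&0&0&0&0&0\\0&0&0&0&1&0\end{pmatrix}. $$ It is isomorphic to the icosahedral group $\mathcal{I}\cong A_5$ (a faithful, crystallographic representation of $\mathcal{I}$). For a subgroup $S$ of $B_6$ write $\mathcal{C}_{B_6}(S) = \{gSg^{-1} : g \in B_6\}$; the class $\mathcal{C}_{B_6}(\hat{\mathcal{I}})$ is the class of crystallographic representations of $\mathcal{I}$ in $B_6$. Let $\mathcal{G}$ be a maximal subgroup of $\mathcal{I}$ and let $\mathcal{K}_{\mathcal{G}} \le \hat{\mathcal{I}}$ be the corresponding (maximal) subgroup of $\hat{\mathcal{I}}$.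 Let $\mathcal{H}, \mathcal{K} \in \mathcal{C}_{B_6}(\hat{\mathcal{I}})$ be such that $\mathcal{H}\cap\mathcal{K} \in \mathcal{C}_{B_6}(\mathcal{K}_{\mathcal{G}})$. Then $\mathcal{H}$ and $\mathcal{K}$ are not conjugate in $B_6^+$, that is, there is no $M \in B_6^+$ with $M\mathcal{H}M^{-1} = \mathcal{K}$. In other words, every $M \in B_6$ with $M\mathcal{H}M^{-1} = \mathcal{K}$ satisfies $\det M = -1$. -/

import Mathlib

namespace Icosahedral

/-- The hyperoctahedral group `B₆ = O(6, ℤ)`: the integral `6 × 6` matrices `A` with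
`A * Aᵀ = Aᵀ * A = 1`. -/
abbrev B6 : Type := Matrix.orthogonalGroup (Fin 6) ℤ

/-- The rotation subgroup `B₆⁺` of the matrices in `B₆` of determinant `1`. -/
def B6Plus : Subgroup B6 where
  carrier := {A | A.1.det = 1}
  mul_mem' := by
    intro a b ha hb
    simp only [Set.mem_ofPred_eq] at ha hb ⊢
    rw [Submonoid.coe_mul, Matrix.det_mul, ha, hb, mul_one]
  one_mem' := by simp
  inv_mem' := by
    intro a ha
    simp only [Set.mem_ofPred_eq] at ha ⊢
    rw [Matrix.UnitaryGroup.inv_val, Matrix.star_eq_conjTranspose, Matrix.det_conjTranspose, ha,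
      star_one]

/-- The image `Î(g₂)` of the generator `g₂` (a two-fold rotation) of the icosahedral group. -/
def g2 : B6 :=
  ⟨!![0, 0,  0,  0, 0, 1;
      0, 0,  0,  0, 1, 0;
      0, 0, -1,  0, 0, 0;
      0, 0,  0, -1, 0, 0;
      0, 1,  0,  0, 0, 0;
      1, 0,  0,  0, 0, 0], by
    rw [Matrix.mem_orthogonalGroup_iff]; decide⟩

/-- The image `Î(g₃)` of the generator `g₃` (a three-fold rotation) of the icosahedral group. -/
def g3 : B6 :=
  ⟨!![0,  0,  0, 0, 0, 1;
      0,  0,  0, 1, 0, 0;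
      0, -1,  0, 0, 0, 0;
      0,  0, -1, 0, 0, 0;
      1,  0,  0, 0, 0, 0;
      0,  0,  0, 0, 1, 0], by
    rw [Matrix.mem_orthogonalGroup_iff]; decide⟩

/-- The crystallographic representation `Î` of the icosahedral group, as a subgroup of `B₆`.
The representation is faithful, so this group is the icosahedral group itself. -/
def icosahedral : Subgroup B6 := Subgroup.closure {g2, g3}

/-- The conjugate `g H g⁻¹` of a subgroup. -/
def conjugate {G : Type*} [Group G] (g : G) (H : Subgroup G) : Subgroup G :=
  H.map (MulAut.conj g).toMonoidHom

/-- The conjugacy class `𝒞_G(H) = {g H g⁻¹ : g ∈ G}` of a subgroup `H` of `G`. -/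
def conjClass {G : Type*} [Group G] (H : Subgroup G) : Set (Subgroup G) :=
  {K | ∃ g : G, conjugate g H = K}

/-- The subgroup `𝒦_𝒢` of `B₆` given by a subgroup `𝒢` of the icosahedral group: the image of `𝒢`
under the representation `Î`. -/
def rep (𝒢 : Subgroup icosahedral) : Subgroup B6 := 𝒢.map icosahedral.subtype

end Icosahedral

/-! Conjugating reduces the claim to `H = Î`, `K = M Î M⁻¹` with `det M = 1`. Replacing `M` by `A *
M` with `A ∈ Î` keeps the determinant and only conjugates `Î ∩ K`. Since `Î` moves any two distinct
signed axes to `e₀` and `±e₁` (`exists_codes_act`), `M` may be assumed to fix `e₀` and send `e₁` to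
`±e₁`. This leaves 384 rotations, and a finite check (`small_code`) shows that each normalizes `Î`
or satisfies `|Î ∩ K| ≤ 4`. Neither case yields a maximal subgroup: a normalizing `M` gives all of
`Î`, and maximal subgroups have more than four elements (`four_lt_card_of_isCoatom`). The check runs
on signed permutations, so matrices are translated by `code`, determinants by `det_eq`, and
membership in `Î` by `mem_codes_iff`. -/

namespace Icosahedral

/-! ### Codes of signed permutations

A signed permutation of the six coordinate axes is recorded as the list of the images of the basis
vectors `e₀, …, e₅`, where `i < 6` stands for `eᵢ` and `i + 6` for `-eᵢ`. -/

/-- The image of a signed axis under a signed permutation. -/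
def act (l : List ℕ) (d : ℕ) : ℕ :=
  if d < 6 then l.getD d 0 else (l.getD (d - 6) 0 + 6) % 12

/-- The product of two signed permutations. -/
def cmul (l m : List ℕ) : List ℕ := m.map (act l)

/-- The number of sign changes plus the number of inversions of a signed permutation. -/
def parity : List ℕ → ℕ
  | [] => 0
  | a :: l => (if a < 6 then 0 else 1) + l.countP (fun b => b % 6 < a % 6) + parity l

/-- The elements of the icosahedral group, sorted by the image of `e₀`. -/
def table : List (List (List ℕ)) :=
  [[[0, 1, 2, 3, 4, 5], [0, 8, 11, 10, 1, 9], [0, 9, 10, 2, 5, 1], [0, 4, 7, 11, 9, 8], [0, 5, 3, 7, 8, 4]],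
   [[1, 0, 8, 11, 10, 9], [1, 2, 3, 4, 0, 5], [1, 9, 11, 6, 2, 10], [1, 10, 6, 3, 5, 2], [1, 5, 4, 8, 9, 0]],
   [[2, 6, 7, 4, 5, 3], [2, 1, 9, 11, 6, 10], [2, 3, 4, 0, 1, 5], [2, 10, 11, 7, 3, 6], [2, 5, 0, 9, 10, 1]],
   [[3, 6, 11, 8, 4, 7], [3, 7, 8, 0, 5, 4], [3, 2, 10, 11, 7, 6], [3, 4, 0, 1, 2, 5], [3, 5, 1, 10, 6, 2]],
   [[4, 0, 1, 2, 3, 5], [4, 7, 11, 9, 0, 8], [4, 8, 9, 1, 5, 0], [4, 3, 6, 11, 8, 7], [4, 5, 2, 6, 7, 3]],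
   [[5, 0, 9, 10, 2, 1], [5, 1, 10, 6, 3, 2], [5, 2, 6, 7, 4, 3], [5, 3, 7, 8, 0, 4], [5, 4, 8, 9, 1, 0]],
   [[6, 7, 4, 5, 2, 3], [6, 2, 1, 9, 11, 10], [6, 3, 5, 1, 10, 2], [6, 10, 9, 8, 7, 11], [6, 11, 8, 4, 3, 7]],
   [[7, 6, 10, 9, 8, 11], [7, 8, 0, 5, 3, 4], [7, 3, 2, 10, 11, 6], [7, 4, 5, 2, 6, 3], [7, 11, 9, 0, 4, 8]],
   [[8, 0, 5, 3, 7, 4], [8, 7, 6, 10, 9, 11], [8, 9, 1, 5, 4, 0], [8, 4, 3, 6, 11, 7], [8, 11, 10, 1, 0, 9]],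
   [[9, 0, 4, 7, 11, 8], [9, 1, 5, 4, 8, 0], [9, 8, 7, 6, 10, 11], [9, 10, 2, 5, 0, 1], [9, 11, 6, 2, 1, 10]],
   [[10, 6, 3, 5, 1, 2], [10, 1, 0, 8, 11, 9], [10, 2, 5, 0, 9, 1], [10, 9, 8, 7, 6, 11], [10, 11, 7, 3, 2, 6]],
   [[11, 6, 2, 1, 9, 10], [11, 7, 3, 2, 10, 6], [11, 8, 4, 3, 6, 7], [11, 9, 0, 4, 7, 8], [11, 10, 1, 0, 8, 9]]]

/-- The codes of the sixty elements of the icosahedral group. -/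
def codes : List (List ℕ) := table.flatten

/-- Whether `l * y * l⁻¹` is in `codes`, if `l` fixes `e₀`. -/
def conjMem (l y : List ℕ) : Bool :=
  (table.getD (act l (y.getD 0 0)) []).any fun x =>
    [1, 2, 3, 4, 5, 0].all fun j => Nat.beq (act x (l.getD j 0)) (act l (y.getD j 0))

/-- Whether a signed permutation fixing `e₀` normalizes the icosahedral group or meets its
conjugate in at most four elements. -/
def small (l : List ℕ) : Bool :=
  (conjMem l [5, 4, 8, 9, 1, 0] && conjMem l [4, 8, 9, 1, 5, 0]) ||
    Nat.ble (codes.countP (conjMem l)) 4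

/-- Whether the axis `d` differs from the axes in `l`. -/
def fresh (l : List ℕ) (d : ℕ) : Bool := l.all fun e => !(Nat.beq (e % 6) (d % 6))

/-- Whether all signed permutations of even parity which map `e₀` to `e₀` and `e₁` to `b` are
`small`. -/
def check (b : ℕ) : Bool :=
  (List.range 12).all fun c => !(fresh [0, b] c) ||
  (List.range 12).all fun d => !(fresh [0, b, c] d) ||
  (List.range 12).all fun e => !(fresh [0, b, c, d] e) ||
  (List.range 12).all fun f => !(fresh [0, b, c, d, e] f) ||
    (!(Nat.beq (parity [0, b, c, d, e, f] % 2) 0) || small [0, b, c, d, e, f])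

/-! ### Finite verifications on signed permutations -/

theorem check_one : check 1 = true := by decide +kernel

theorem check_seven : check 7 = true := by decide +kernel

theorem mem_table_getD : ∀ l ∈ codes, l ∈ table.getD (l.getD 0 0) [] := by decide +kernel

theorem codes_nodup : codes.Nodup := by decide +kernel

theorem codes_length : codes.length = 60 := by decide +kernel

/-- Stability under the two generators shows that the list contains the whole generated group. -/
theorem cmul_mem_codes : ∀ l ∈ codes, cmul [5, 4, 8, 9, 1, 0] l ∈ codes ∧
    cmul [4, 8, 9, 1, 5, 0] l ∈ codes := by decide +kernel

/-- The icosahedral group moves any two distinct axes to the first two. -/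
theorem exists_codes_act : ∀ a < 12, ∀ b < 12, a % 6 ≠ b % 6 →
    ∃ x ∈ codes, act x a = 0 ∧ (act x b = 1 ∨ act x b = 7) := by decide +kernel

/-- All products of elements of two lists. -/
def mulList (s t : List (List ℕ)) : List (List ℕ) := s.flatMap fun l => t.map (cmul l)

/-- The powers of a five-fold rotation. -/
def fivefold : List (List ℕ) :=
  (List.range 5).map fun n => (cmul (cmul [5, 4, 8, 9, 1, 0] [4, 8, 9, 1, 5, 0]))^[n] [0, 1, 2, 3, 4, 5]

/-- A word in the generators which inverts the five-fold rotation. -/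
def twofold : List ℕ :=
  let a := [5, 4, 8, 9, 1, 0]
  let b := [4, 8, 9, 1, 5, 0]
  cmul b (cmul a (cmul b (cmul a (cmul b (cmul b (cmul a (cmul b a)))))))

/-- With `C` the cyclic group of order five and `u` the two-fold word, this is the decomposition `C
(1 ∪ g₂ C) {1, u}`, with 5 · 6 · 2 = 60 products. It makes every listed code a word in the
generators. -/
theorem codes_subset : ∀ l ∈ codes, l ∈ mulList (mulList fivefold
    ([0, 1, 2, 3, 4, 5] :: mulList [[5, 4, 8, 9, 1, 0]] fivefold)) [[0, 1, 2, 3, 4, 5], twofold] := by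
  decide +kernel

theorem length_filter_commute :
    (codes.filter fun x => cmul x [1, 0, 10, 5, 8, 3] = cmul [1, 0, 10, 5, 8, 3] x).length = 12 := by
  decide +kernel

/-! ### The code of an orthogonal integral matrix -/

/-- The image of the `j`-th basis vector under a signed permutation matrix. -/
def dig (A : B6) (j : Fin 6) : ℕ :=
  ∑ i, if A.1 i j = 1 then i.val else if A.1 i j = -1 then i.val + 6 else 0

/-- The signed permutation given by a matrix. -/
def code (A : B6) : List ℕ := [dig A 0, dig A 1, dig A 2, dig A 3, dig A 4, dig A 5]

theorem code_getD (A : B6) (j : Fin 6) : (code A).getD j 0 = dig A j := by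
  fin_cases j <;> rfl

theorem col_inner (A : B6) (j k : Fin 6) :
    ∑ i, A.1 i j * A.1 i k = if j = k then 1 else 0 := by
  have h := congrFun (congrFun ((Matrix.mem_orthogonalGroup_iff' _ _).1 A.2) j) k
  rw [Matrix.mul_apply] at h
  simpa [Matrix.one_apply, Matrix.star_eq_conjTranspose] using h

/-- The squares in a column are nonnegative integers with sum one, so a nonzero entry uses up the
whole sum. -/
theorem exists_col (A : B6) (j : Fin 6) :
    ∃ i, (A.1 i j = 1 ∨ A.1 i j = -1) ∧ ∀ k, k ≠ i → A.1 k j = 0 := by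
  have h := col_inner A j j
  rw [if_pos rfl] at h
  obtain ⟨i, hi⟩ : ∃ i, A.1 i j ≠ 0 := by
    by_contra! h0
    simp [h0] at h
  have hpos : 1 ≤ A.1 i j * A.1 i j := by
    have := mul_self_pos.2 hi
    omega
  rw [← Finset.add_sum_erase _ _ (Finset.mem_univ i)] at h
  have hnn : ∀ k ∈ Finset.univ.erase i, 0 ≤ A.1 k j * A.1 k j := fun k _ => mul_self_nonneg _
  have hs := Finset.sum_nonneg hnn
  have h0 : ∑ k ∈ Finset.univ.erase i, A.1 k j * A.1 k j = 0 := by omega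
  refine ⟨i, mul_self_eq_one_iff.1 (by omega), fun k hk => ?_⟩
  exact mul_self_eq_zero.1
    ((Finset.sum_eq_zero_iff_of_nonneg hnn).1 h0 k (Finset.mem_erase.2 ⟨hk, Finset.mem_univ k⟩))

theorem dig_eq {A : B6} {i j : Fin 6} (h : ∀ k, k ≠ i → A.1 k j = 0) :
    dig A j = if A.1 i j = 1 then i.val else if A.1 i j = -1 then i.val + 6 else 0 :=
  Finset.sum_eq_single i (fun k _ hk => by simp [h k hk]) (by simp)

theorem exists_dig (A : B6) (j : Fin 6) : ∃ i : Fin 6, (∀ k, k ≠ i → A.1 k j = 0) ∧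
    (A.1 i j = 1 ∧ dig A j = i.val ∨ A.1 i j = -1 ∧ dig A j = i.val + 6) := by
  obtain ⟨i, hi, h⟩ := exists_col A j
  refine ⟨i, h, ?_⟩
  rw [dig_eq h]
  rcases hi with hi | hi <;> simp [hi]

theorem dig_lt (A : B6) (j : Fin 6) : dig A j < 12 := by
  obtain ⟨i, -, h⟩ := exists_dig A j
  omega

theorem apply_eq_one_iff (A : B6) (i j : Fin 6) : A.1 i j = 1 ↔ dig A j = i.val := by
  obtain ⟨k, h0, h⟩ := exists_dig A j
  by_cases hk : i = k
  · subst hk; omega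
  · have := h0 i hk
    rw [Fin.ext_iff] at hk
    omega

theorem apply_eq_neg_one_iff (A : B6) (i j : Fin 6) : A.1 i j = -1 ↔ dig A j = i.val + 6 := by
  obtain ⟨k, h0, h⟩ := exists_dig A j
  by_cases hk : i = k
  · subst hk; omega
  · have := h0 i hk
    rw [Fin.ext_iff] at hk
    omega

theorem apply_eq (A : B6) (i j : Fin 6) :
    A.1 i j = if dig A j = i.val then 1 else if dig A j = i.val + 6 then -1 else 0 := by
  obtain ⟨k, h0, h⟩ := exists_dig A j
  have h1 := apply_eq_one_iff A i j
  have h2 := apply_eq_neg_one_iff A i j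
  by_cases hk : i = k
  · subst hk; split_ifs <;> omega
  · have := h0 i hk
    split_ifs <;> omega

/-- Two distinct columns supported in the same row would have inner product `±1` instead of `0`. -/
theorem dig_mod_injective (A : B6) {j k : Fin 6} (h : dig A j % 6 = dig A k % 6) : j = k := by
  by_contra hne
  obtain ⟨a, ha0, ha⟩ := exists_dig A j
  obtain ⟨b, hb0, hb⟩ := exists_dig A k
  obtain rfl : a = b := by
    rw [Fin.ext_iff]; omega
  have hs := col_inner A j k
  rw [if_neg hne, Finset.sum_eq_single a (fun i _ hi => by rw [ha0 i hi, zero_mul]) (by simp)] at hs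
  rcases ha with ⟨ha, -⟩ | ⟨ha, -⟩ <;> rcases hb with ⟨hb, -⟩ | ⟨hb, -⟩ <;> simp [ha, hb] at hs

theorem code_injective : Function.Injective code := by
  intro A B h
  have hd : ∀ j, dig A j = dig B j := fun j => by rw [← code_getD, ← code_getD, h]
  ext i j
  rw [apply_eq, apply_eq, hd]

theorem dig_mul (A B : B6) (j : Fin 6) : dig (A * B) j = act (code A) (dig B j) := by
  obtain ⟨k, hk0, hk⟩ := exists_dig B j
  obtain ⟨i, hi0, hi⟩ := exists_dig A k
  have hm : ∀ r, (A * B).1 r j = A.1 r k * B.1 k j := fun r => by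
    rw [Submonoid.coe_mul, Matrix.mul_apply]
    exact Finset.sum_eq_single k (fun s _ hs => by rw [hk0 s hs, mul_zero]) (by simp)
  have h0 : ∀ r, r ≠ i → (A * B).1 r j = 0 := fun r hr => by rw [hm, hi0 r hr, zero_mul]
  rw [dig_eq h0, hm]
  have hg := code_getD A k
  have hi6 := i.isLt
  have hk6 := k.isLt
  rcases hk with ⟨hk, hk'⟩ | ⟨hk, hk'⟩ <;> rcases hi with ⟨hi, hi'⟩ | ⟨hi, hi'⟩ <;>
    simp only [hk, hk', hi, act, Nat.add_sub_cancel, hg, hi'] <;> norm_num <;> omega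

theorem code_mul (A B : B6) : code (A * B) = cmul (code A) (code B) := by
  simp [code, cmul, dig_mul]

theorem code_one : code 1 = [0, 1, 2, 3, 4, 5] := by decide +kernel

theorem code_g2 : code g2 = [5, 4, 8, 9, 1, 0] := by decide +kernel

theorem code_g3 : code g3 = [4, 8, 9, 1, 5, 0] := by decide +kernel

/-! ### The determinant -/

/-- The matrix is a permutation matrix with its columns scaled by signs. The scaling contributes the
sign changes, the permutation its inversions. -/
theorem det_eq (A : B6) : A.1.det = (-1) ^ parity (code A) := by
  have hlt : ∀ j, dig A j % 6 < 6 := fun j => Nat.mod_lt _ (by norm_num)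
  let f : Fin 6 → Fin 6 := fun j => ⟨dig A j % 6, hlt j⟩
  have hf : Function.Injective f := fun j k h => dig_mod_injective A (Fin.ext_iff.1 h)
  let σ : Equiv.Perm (Fin 6) := Equiv.ofBijective f (Finite.injective_iff_bijective.1 hf)
  have hσ : ∀ j, (σ j).val = dig A j % 6 := fun _ => rfl
  have hA : A.1 = Matrix.of fun i j => (if dig A j < 6 then (1 : ℤ) else -1) *
      ((1 : Matrix (Fin 6) (Fin 6) ℤ).submatrix id σ) i j := by
    ext i j
    have h1 := dig_lt A j
    have h2 := i.isLt
    rw [apply_eq]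
    simp only [Matrix.of_apply, Matrix.submatrix_apply, id, Matrix.one_apply, Fin.ext_iff, hσ]
    split_ifs <;> first | rfl | omega
  have e1 : ∀ j, (if dig A j < 6 then (1 : ℤ) else -1) = (-1) ^ (if dig A j < 6 then 0 else 1) :=
    fun j => by split_ifs <;> rfl
  have e2 : ∀ i j, i ≠ j → (if σ i < σ j then (1 : ℤ) else -1) =
      (-1) ^ (if dig A j % 6 < dig A i % 6 then 1 else 0) := fun i j hij => by
    have hne : dig A i % 6 ≠ dig A j % 6 := fun h => hij (dig_mod_injective A h)
    simp only [Fin.lt_def, hσ]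
    split_ifs <;> first | rfl | omega
  have hs : (σ.sign : ℤ) = ∏ i, ∏ j ∈ Finset.Ioi i,
      (-1) ^ (if dig A j % 6 < dig A i % 6 then 1 else 0) := by
    rw [Equiv.Perm.sign_eq_prod_prod_Ioi, Units.coe_prod]
    refine Finset.prod_congr rfl fun i _ => ?_
    rw [Units.coe_prod]
    refine Finset.prod_congr rfl fun j hj => ?_
    rw [← e2 i j (Finset.mem_Ioi.1 hj).ne]
    split_ifs <;> rfl
  have hI : ∀ g : Fin 6 → Fin 6 → ℕ, ∑ i, ∑ j ∈ Finset.Ioi i, g i j =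
      (g 0 1 + g 0 2 + g 0 3 + g 0 4 + g 0 5) + (g 1 2 + g 1 3 + g 1 4 + g 1 5) +
      (g 2 3 + g 2 4 + g 2 5) + (g 3 4 + g 3 5) + g 4 5 := fun g => by
    have h0 : Finset.Ioi (0 : Fin 6) = {1, 2, 3, 4, 5} := by decide
    have h1 : Finset.Ioi (1 : Fin 6) = {2, 3, 4, 5} := by decide
    have h2 : Finset.Ioi (2 : Fin 6) = {3, 4, 5} := by decide
    have h3 : Finset.Ioi (3 : Fin 6) = {4, 5} := by decide
    have h4 : Finset.Ioi (4 : Fin 6) = {5} := by decide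
    have h5 : Finset.Ioi (5 : Fin 6) = ∅ := by decide
    simp [Fin.sum_univ_six, h0, h1, h2, h3, h4, h5, add_assoc]
  rw [hA, Matrix.det_mul_row, Matrix.det_permute', Matrix.det_one, mul_one, Int.cast_id, hs]
  simp only [e1, Finset.prod_pow_eq_pow_sum, ← pow_add]
  rw [hI, Fin.sum_univ_six]
  simp only [code, parity, List.countP_cons, List.countP_nil, decide_eq_true_eq]
  congr 1
  ring

/-! ### The icosahedral group and its maximal subgroups -/

theorem g2_mem : g2 ∈ icosahedral := Subgroup.subset_closure (by simp)

theorem g3_mem : g3 ∈ icosahedral := Subgroup.subset_closure (by simp)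

theorem g2_inv : g2⁻¹ = g2 := inv_eq_of_mul_eq_one_right (code_injective (by
  rw [code_mul, code_g2, code_one]; decide +kernel))

theorem g3_inv : g3⁻¹ = g3 * g3 := inv_eq_of_mul_eq_one_right (code_injective (by
  rw [code_mul, code_mul, code_g3, code_one]; decide +kernel))

theorem code_mem {A : B6} (hA : A ∈ icosahedral) : code A ∈ codes := by
  induction hA using Subgroup.closure_induction_left with
  | one => rw [code_one]; decide +kernel
  | mul_left x hx y _ hy =>
    rw [code_mul]
    rcases hx with rfl | rfl
    · rw [code_g2]; exact (cmul_mem_codes _ hy).1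
    · rw [code_g3]; exact (cmul_mem_codes _ hy).2
  | inv_mul_cancel x hx y _ hy =>
    rw [code_mul]
    rcases hx with rfl | rfl
    · rw [g2_inv, code_g2]; exact (cmul_mem_codes _ hy).1
    · rw [← code_mul, g3_inv, mul_assoc, code_mul, code_mul, code_g3]
      exact (cmul_mem_codes _ (cmul_mem_codes _ hy).2).2

/-- The codes of the elements of a subgroup. -/
def IsCodeOf (S : Subgroup B6) (l : List ℕ) : Prop := ∃ A ∈ S, code A = l

theorem IsCodeOf.mul {S : Subgroup B6} {l m : List ℕ} (hl : IsCodeOf S l) (hm : IsCodeOf S m) :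
    IsCodeOf S (cmul l m) := by
  obtain ⟨A, hA, rfl⟩ := hl
  obtain ⟨B, hB, rfl⟩ := hm
  exact ⟨A * B, mul_mem hA hB, code_mul A B⟩

theorem IsCodeOf.mulList {S : Subgroup B6} {s t : List (List ℕ)} (hs : ∀ l ∈ s, IsCodeOf S l)
    (ht : ∀ l ∈ t, IsCodeOf S l) : ∀ l ∈ mulList s t, IsCodeOf S l := by
  intro l hl
  simp only [Icosahedral.mulList, List.mem_flatMap, List.mem_map] at hl
  obtain ⟨a, ha, b, hb, rfl⟩ := hl
  exact (hs a ha).mul (ht b hb)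

theorem mem_codes_iff (l : List ℕ) : l ∈ codes ↔ IsCodeOf icosahedral l := by
  refine ⟨fun h => ?_, fun ⟨A, hA, h⟩ => h ▸ code_mem hA⟩
  have h1 : IsCodeOf icosahedral [0, 1, 2, 3, 4, 5] := ⟨1, one_mem _, code_one⟩
  have h2 : IsCodeOf icosahedral [5, 4, 8, 9, 1, 0] := ⟨g2, g2_mem, code_g2⟩
  have h3 : IsCodeOf icosahedral [4, 8, 9, 1, 5, 0] := ⟨g3, g3_mem, code_g3⟩
  have h5 : ∀ l ∈ fivefold, IsCodeOf icosahedral l := by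
    intro l hl
    simp only [fivefold, List.mem_map] at hl
    obtain ⟨n, -, rfl⟩ := hl
    induction n with
    | zero => exact h1
    | succ n ih => rw [Function.iterate_succ_apply']; exact (h2.mul h3).mul ih
  have hu : IsCodeOf icosahedral twofold :=
    h3.mul (h2.mul (h3.mul (h2.mul (h3.mul (h3.mul (h2.mul (h3.mul h2)))))))
  refine IsCodeOf.mulList (IsCodeOf.mulList h5 ?_) ?_ l (codes_subset l h)
  · simp only [List.forall_mem_cons]
    exact ⟨h1, IsCodeOf.mulList (by simpa using h2) h5⟩
  · simpa using ⟨h1, hu⟩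

theorem card_eq_length {S : Subgroup B6} {s : List (List ℕ)} (hs : s.Nodup)
    (h : ∀ l, l ∈ s ↔ IsCodeOf S l) : Nat.card S = s.length := by
  have himg : code '' (S : Set B6) = (s.toFinset : Set (List ℕ)) := by
    ext l
    simp [h, IsCodeOf]
  rw [← List.toFinset_card_of_nodup hs, ← Set.ncard_coe_finset, ← himg,
    Set.ncard_image_of_injective _ code_injective]
  rfl

theorem card_icosahedral : Nat.card icosahedral = 60 := by
  rw [card_eq_length codes_nodup mem_codes_iff, codes_length]

instance : Finite icosahedral := Nat.finite_of_card_ne_zero (by simp [card_icosahedral])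

/-- A signed permutation whose centralizer in the icosahedral group is a tetrahedral group. -/
def pairing : B6 :=
  ⟨!![0, 1,  0, 0,  0, 0;
      1, 0,  0, 0,  0, 0;
      0, 0,  0, 0, -1, 0;
      0, 0,  0, 0,  0, 1;
      0, 0, -1, 0,  0, 0;
      0, 0,  0, 1,  0, 0], by
    rw [Matrix.mem_orthogonalGroup_iff]; decide⟩

theorem code_pairing : code pairing = [1, 0, 10, 5, 8, 3] := by decide +kernel

/-- A tetrahedral subgroup of the icosahedral group. -/
def tetrahedral : Subgroup icosahedral :=
  (icosahedral ⊓ Subgroup.centralizer {pairing}).subgroupOf icosahedral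

theorem card_tetrahedral : Nat.card tetrahedral = 12 := by
  rw [tetrahedral, Nat.card_congr (Subgroup.subgroupOfEquivOfLe inf_le_left).toEquiv,
    card_eq_length (codes_nodup.filter _), length_filter_commute]
  intro l
  rw [List.mem_filter, mem_codes_iff]
  simp only [decide_eq_true_eq, IsCodeOf, ← code_pairing]
  constructor
  · rintro ⟨⟨A, hA, rfl⟩, h⟩
    rw [← code_mul, ← code_mul] at h
    refine ⟨A, ⟨hA, Subgroup.mem_centralizer_singleton_iff.2 (code_injective h)⟩, rfl⟩
  · rintro ⟨A, ⟨hA, hc⟩, rfl⟩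
    refine ⟨⟨A, hA, rfl⟩, ?_⟩
    rw [← code_mul, ← code_mul, Subgroup.mem_centralizer_singleton_iff.1 hc]

theorem index_tetrahedral : tetrahedral.index = 5 := by
  have h := tetrahedral.card_mul_index
  rw [card_tetrahedral, card_icosahedral] at h
  omega

/-- In a group of order `60` with a subgroup `T` of index `5`, a maximal subgroup has more than four elements: a smaller subgroup is
a `2`-group or a `3`-group, hence fixes one of the five cosets of `T`. -/
theorem four_lt_card_of_isCoatom {Γ : Type*} [Group Γ] (hΓ : Nat.card Γ = 60) {T : Subgroup Γ}
    (hT : T.index = 5) {G : Subgroup Γ} (hG : IsCoatom G) : 4 < Nat.card G := by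
  by_contra! hle
  have : Finite Γ := Nat.finite_of_card_ne_zero (by omega)
  obtain ⟨p, n, hp, hn, hpn⟩ : ∃ p n : ℕ, p.Prime ∧ Nat.card G = p ^ n ∧ ¬ p ∣ 5 := by
    have hpos : 0 < Nat.card G := Nat.card_pos
    generalize Nat.card G = c at *
    interval_cases c
    · exact ⟨2, 0, by norm_num⟩
    · exact ⟨2, 1, by norm_num⟩
    · exact ⟨3, 1, by norm_num⟩
    · exact ⟨2, 2, by norm_num⟩
  have := Fact.mk hp
  have h5 : Nat.card (Γ ⧸ T) = 5 := hT
  have : Finite (Γ ⧸ T) := Nat.finite_of_card_ne_zero (by omega)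
  obtain ⟨q, hq⟩ := (IsPGroup.of_card hn).nonempty_fixed_point_of_prime_not_dvd_card
    (Γ ⧸ T) (by rwa [h5])
  have hle' : G ≤ MulAction.stabilizer Γ q := fun g hg => hq ⟨g, hg⟩
  have hindex : (MulAction.stabilizer Γ q).index = 5 := by
    rw [MulAction.index_stabilizer_of_transitive, h5]
  -- By maximality the stabilizer is the whole group, of index 1, or `G` itself, which then has
  -- order 60 / 5 = 12.
  rcases hG.le_iff.1 hle' with h | h
  · rw [h, Subgroup.index_top] at hindex
    omega
  · have hm := (MulAction.stabilizer Γ q).card_mul_index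
    rw [hindex, h, hΓ] at hm
    omega

/-! ### Conjugates of the icosahedral group -/

theorem mem_conjugate {G : Type*} [Group G] {g x : G} {H : Subgroup G} :
    x ∈ conjugate g H ↔ g⁻¹ * x * g ∈ H := by
  constructor
  · rintro ⟨y, hy, rfl⟩
    simpa [mul_assoc] using hy
  · intro h
    exact ⟨_, h, by simp [mul_assoc]⟩

theorem conjugate_conjugate {G : Type*} [Group G] (g h : G) (H : Subgroup G) :
    conjugate g (conjugate h H) = conjugate (g * h) H := by
  ext x
  simp [mem_conjugate, mul_assoc]

theorem conjugate_of_mem {G : Type*} [Group G] {g : G} {H : Subgroup G} (hg : g ∈ H) :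
    conjugate g H = H := by
  ext x
  rw [mem_conjugate, H.mul_mem_cancel_right hg, H.mul_mem_cancel_left (inv_mem hg)]

theorem conjugate_inf {G : Type*} [Group G] (g : G) (H K : Subgroup G) :
    conjugate g (H ⊓ K) = conjugate g H ⊓ conjugate g K := by
  ext x
  simp [mem_conjugate]

theorem card_conjugate {G : Type*} [Group G] (g : G) (H : Subgroup G) :
    Nat.card (conjugate g H) = Nat.card H :=
  Nat.card_congr (H.equivMapOfInjective _ (MulAut.conj g).injective).symm.toEquiv

theorem conjugate_mem_conjClass {G : Type*} [Group G] (g : G) {H K : Subgroup G}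
    (h : K ∈ conjClass H) : conjugate g K ∈ conjClass H := by
  obtain ⟨c, rfl⟩ := h
  exact ⟨g * c, (conjugate_conjugate g c H).symm⟩

theorem act_code (A : B6) (j : Fin 6) : act (code A) j = dig A j := by
  rw [act, if_pos j.isLt, code_getD]

/-- Testing `X * M = M * A` column by column avoids inverting `M`. As `M` fixes `e₀`, the image of
`e₀` under `X` must be that under `M * A`, so one block of the table suffices. -/
theorem conjMem_iff {M A : B6} (hM : dig M 0 = 0) :
    conjMem (code M) (code A) = true ↔ M * A * M⁻¹ ∈ icosahedral := by
  have key : ∀ X : B6, (∀ j : Fin 6, act (code X) (dig M j) = act (code M) (dig A j)) ↔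
      X = M * A * M⁻¹ := fun X => by
    simp only [← dig_mul]
    rw [eq_mul_inv_iff_mul_eq]
    refine ⟨fun h => code_injective ?_, fun h j => by rw [h]⟩
    simp only [code, h]
  have hall : ∀ X : B6, (([1, 2, 3, 4, 5, 0].all fun j =>
      Nat.beq (act (code X) ((code M).getD j 0)) (act (code M) ((code A).getD j 0))) = true) ↔
      X = M * A * M⁻¹ := fun X => by
    rw [← key]
    simp only [List.all_cons, List.all_nil, Bool.and_true, Bool.and_eq_true, Nat.beq_eq,
      Fin.forall_fin_succ, ← code_getD]
    simp
    tauto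
  rw [conjMem, List.any_eq_true]
  constructor
  · rintro ⟨x, hx, h⟩
    have hx' : x ∈ codes := by
      rw [List.getD_eq_getElem?_getD] at hx
      rcases lt_or_ge (act (code M) ((code A).getD 0 0)) table.length with hlt | hge
      · rw [List.getElem?_eq_getElem hlt] at hx
        exact List.mem_flatten.2 ⟨_, List.getElem_mem hlt, hx⟩
      -- Outside the table the default block is empty.
      · rw [List.getElem?_eq_none hge] at hx
        simp at hx
    obtain ⟨X, hX, rfl⟩ := (mem_codes_iff x).1 hx'
    rwa [← (hall X).1 h]
  · intro h
    refine ⟨_, ?_, (hall _).2 rfl⟩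
    have h0 := (key _).2 rfl 0
    have hc := mem_table_getD _ (code_mem h)
    have ha := act_code (M * A * M⁻¹) 0
    rw [← code_getD] at ha
    rw [hM] at h0
    have hg := code_getD A 0
    simp only [Fin.val_zero] at ha hg
    rwa [hg, ← h0, ha]

/-! ### Intersections of the icosahedral group with its conjugates by rotations -/

theorem of_all_range {l : List ℕ} {d : ℕ} {P : ℕ → Bool}
    (h : ((List.range 12).all fun c => !(fresh l c) || P c) = true) (hd : d < 12)
    (hl : ∀ e ∈ l, e % 6 ≠ d % 6) : P d = true := by
  have hf : fresh l d = true := by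
    refine List.all_eq_true.2 fun e he => ?_
    cases h : Nat.beq (e % 6) (d % 6)
    · rfl
    · exact absurd (Nat.eq_of_beq_eq_true h) (hl e he)
  simpa [hf] using List.all_eq_true.1 h d (List.mem_range.2 hd)

theorem small_code {M : B6} (hdet : M.1.det = 1) (h0 : dig M 0 = 0)
    (h1 : dig M 1 = 1 ∨ dig M 1 = 7) : small (code M) = true := by
  have hb : check (dig M 1) = true := by
    rcases h1 with h | h <;> rw [h]
    · exact check_one
    · exact check_seven
  have hpar : parity (code M) % 2 = 0 := by
    rw [det_eq] at hdet
    exact Nat.even_iff.1 ((neg_one_pow_eq_one_iff_even (by norm_num)).1 hdet)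
  have hne : ∀ j k : Fin 6, j ≠ k → dig M j % 6 ≠ dig M k % 6 :=
    fun j k hjk h => hjk (dig_mod_injective M h)
  have hc : code M = [0, dig M 1, dig M 2, dig M 3, dig M 4, dig M 5] := by rw [code, h0]
  have hz : ∀ j : Fin 6, 0 ≠ j → 0 % 6 ≠ dig M j % 6 := fun j hj => h0 ▸ hne 0 j hj
  have h2 := of_all_range hb (dig_lt M 2) (by
    simp only [List.forall_mem_cons]
    exact ⟨hz 2 (by decide), hne 1 2 (by decide), by simp⟩)
  have h3 := of_all_range h2 (dig_lt M 3) (by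
    simp only [List.forall_mem_cons]
    exact ⟨hz 3 (by decide), hne 1 3 (by decide), hne 2 3 (by decide), by simp⟩)
  have h4 := of_all_range h3 (dig_lt M 4) (by
    simp only [List.forall_mem_cons]
    exact ⟨hz 4 (by decide), hne 1 4 (by decide), hne 2 4 (by decide), hne 3 4 (by decide),
      by simp⟩)
  have h5 := of_all_range h4 (dig_lt M 5) (by
    simp only [List.forall_mem_cons]
    exact ⟨hz 5 (by decide), hne 1 5 (by decide), hne 2 5 (by decide), hne 3 5 (by decide),
      hne 4 5 (by decide), by simp⟩)
  rw [← hc, hpar] at h5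
  simpa using h5

/-- If `M` is a rotation, then the icosahedral group either agrees with its conjugate by `M` or
meets it in at most four elements, provided that `M` fixes `e₀` and maps `e₁` to `±e₁`. -/
theorem le_conjugate_or_card_le {M : B6} (hdet : M.1.det = 1) (h0 : dig M 0 = 0)
    (h1 : dig M 1 = 1 ∨ dig M 1 = 7) :
    conjugate M icosahedral ≤ icosahedral ∨
      Nat.card (icosahedral ⊓ conjugate M icosahedral : Subgroup B6) ≤ 4 := by
  have h := small_code hdet h0 h1
  rw [small, Bool.or_eq_true, Bool.and_eq_true, ← code_g2, ← code_g3, conjMem_iff h0,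
    conjMem_iff h0] at h
  refine h.imp (fun h => ?_) (fun h => ?_)
  · have hle : icosahedral ≤ icosahedral.comap (MulAut.conj M).toMonoidHom :=
      (Subgroup.closure_le _).2 (by
        rintro x (rfl | rfl)
        · exact h.1
        · exact h.2)
    exact Subgroup.map_le_iff_le_comap.2 hle
  -- Conjugating back by `M⁻¹` turns the intersection into the set of `A ∈ Î` with `M * A * M⁻¹ ∈
  -- Î`, which is what the check counts.
  · rw [← card_conjugate M⁻¹, conjugate_inf, conjugate_conjugate, inv_mul_cancel]
    set S : Subgroup B6 := conjugate M⁻¹ icosahedral ⊓ conjugate 1 icosahedral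
    have himg : code '' (S : Set B6) ⊆
        ((codes.filter (conjMem (code M))).toFinset : Set (List ℕ)) := by
      rintro _ ⟨A, ⟨hA1, hA2⟩, rfl⟩
      have hA1' := mem_conjugate.1 hA1
      have hA2' := mem_conjugate.1 hA2
      rw [inv_inv] at hA1'
      rw [inv_one, one_mul, mul_one] at hA2'
      simpa using ⟨code_mem hA2', (conjMem_iff h0).2 hA1'⟩
    calc Nat.card S = (code '' (S : Set B6)).ncard :=
          (Set.ncard_image_of_injective _ code_injective).symm
      _ ≤ _ := Set.ncard_le_ncard himg (Finset.finite_toSet _)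
      _ ≤ codes.countP (conjMem (code M)) := by
          rw [Set.ncard_coe_finset, List.countP_eq_length_filter]
          exact List.toFinset_card_le _
      _ ≤ 4 := Nat.le_of_ble_eq_true h

theorem exists_mul_dig (M : B6) : ∃ A ∈ icosahedral,
    dig (A * M) 0 = 0 ∧ (dig (A * M) 1 = 1 ∨ dig (A * M) 1 = 7) := by
  obtain ⟨x, hx, h⟩ := exists_codes_act _ (dig_lt M 0) _ (dig_lt M 1)
    (fun h => absurd (dig_mod_injective M h) (by decide))
  obtain ⟨A, hA, rfl⟩ := (mem_codes_iff x).1 hx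
  exact ⟨A, hA, by rwa [dig_mul, dig_mul]⟩

theorem det_eq_one {A : B6} (hA : A ∈ icosahedral) : A.1.det = 1 := by
  have h : icosahedral ≤ B6Plus := (Subgroup.closure_le _).2 (by
    rintro x (rfl | rfl)
    · change g2.1.det = 1
      rw [det_eq, code_g2]; decide +kernel
    · change g3.1.det = 1
      rw [det_eq, code_g3]; decide +kernel)
  exact h hA

/-- A rotation `M` does not make the icosahedral group meet its conjugate by `M` in a maximal
subgroup. -/
theorem inf_conjugate_notMem_conjClass {M : B6} (hdet : M.1.det = 1) {G : Subgroup icosahedral}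
    (hG : IsCoatom G) : icosahedral ⊓ conjugate M icosahedral ∉ conjClass (rep G) := by
  intro hP
  obtain ⟨A, hA, h0, h1⟩ := exists_mul_dig M
  have hP' := conjugate_mem_conjClass A hP
  rw [conjugate_inf, conjugate_of_mem hA, conjugate_conjugate] at hP'
  obtain ⟨c, hc⟩ := hP'
  have hcard : Nat.card (icosahedral ⊓ conjugate (A * M) icosahedral : Subgroup B6) =
      Nat.card G := by
    rw [← hc, card_conjugate]
    exact Nat.card_congr (G.equivMapOfInjective _ icosahedral.subtype_injective).symm.toEquiv
  have hdet' : (A * M).1.det = 1 := by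
    rw [Submonoid.coe_mul, Matrix.det_mul, det_eq_one hA, hdet, one_mul]
  rcases le_conjugate_or_card_le hdet' h0 h1 with h | h
  · rw [inf_eq_right.2 h, card_conjugate] at hcard
    -- The intersection is the full conjugate, so `G` would have the order of `Î`.
    exact hG.1 (Subgroup.eq_top_of_card_eq _ hcard.symm)
  · have := four_lt_card_of_isCoatom card_icosahedral index_tetrahedral hG
    omega

end Icosahedral

theorem mainTheorem6
    (H K : Subgroup Icosahedral.B6)
    (hH : H ∈ Icosahedral.conjClass Icosahedral.icosahedral)
    (hK : K ∈ Icosahedral.conjClass Icosahedral.icosahedral)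
    (𝒢 : Subgroup Icosahedral.icosahedral) (h𝒢 : IsCoatom 𝒢)
    (hP : H ⊓ K ∈ Icosahedral.conjClass (Icosahedral.rep 𝒢)) :
    (¬ ∃ M ∈ Icosahedral.B6Plus, Icosahedral.conjugate M H = K) ∧
      ∀ M : Icosahedral.B6, Icosahedral.conjugate M H = K → M.1.det = -1 := by
  have key : ∀ M : Icosahedral.B6, Icosahedral.conjugate M H = K → M.1.det ≠ 1 := by
    rintro M rfl hdet
    obtain ⟨g, rfl⟩ := hH
    -- After conjugation by `g⁻¹` the first group is `Î`, and `M` becomes `g⁻¹ * M * g`, with the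
    -- same determinant.
    have h := Icosahedral.conjugate_mem_conjClass g⁻¹ hP
    simp only [Icosahedral.conjugate_inf, Icosahedral.conjugate_conjugate] at h
    rw [inv_mul_cancel, Icosahedral.conjugate_of_mem (one_mem _)] at h
    refine Icosahedral.inf_conjugate_notMem_conjClass ?_ h𝒢 h
    have hg : g⁻¹.1.det * g.1.det = 1 := by
      rw [← Matrix.det_mul, ← Submonoid.coe_mul, inv_mul_cancel]
      simp
    rw [Submonoid.coe_mul, Submonoid.coe_mul, Matrix.det_mul, Matrix.det_mul, hdet, one_mul, hg]
  refine ⟨fun ⟨M, hM, h⟩ => key M h hM, fun M h => ?_⟩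
  refine (neg_one_pow_eq_or ℤ _).elim (fun h1 => absurd h1 ?_) (Icosahedral.det_eq M).trans
  rw [← Icosahedral.det_eq]
  exact key M h
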